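/- All graphs are simple, with nonempty vertex set, finite or infinite, and not necessarily connected. A graph $G$ is regarded as a metric graph: every edge is identified with the interval $[0,1]$, so that the points of $G$ are its vertices and the interior points of its edges, and the distance $d_G(x,y)$ of two points is the length of a shortest path from $x$ to $y$ in $G$ ($\infty$ if they lie in different connected components). A geodesic triangle $T$ in a metric space $X$ consists of three points $x_1,x_2,x_3$ and three geodesics $[x_1x_2]$, $[x_2x_3]$, $[x_3x_1]$ (curves parametrized by arc length whose lengths equal the distances of their endpoints); $\delta(T)$ is the infimum of the $\delta\ge 0$ such that every point of each side is at distance at most $\delta$ from the union of the two other sides. The hyperbolicity constant $\delta(X)\in[0,\infty]$ of a connected $X$ is the supremum of $\delta(T)$ over all geodesic triangles $T$ in $X$; if $X$ has connected components $X_i$, then $\delta(X)=\sup_i\delta(X_i)$. For two graphs $G_1,G_2$ with disjoint vertex sets, the graph join $G_1\uplus G_2$ is the graph with vertex set $V(G_1)\cup V(G_2)$ whose edges are those of $G_1$, those of $G_2$, and all the edges joining a vertex of $G_1$ to a vertex of $G_2$. Let $G_1,G_2$ be two graphs. Then $$\delta(G_1\uplus G_2)\ \ge\ \min\Big\{\tfrac54,\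 \max\{\delta(G_1),\delta(G_2)\}\Big\}.$$ -/

import Mathlib

open scoped ENNReal NNReal

universe u v

/-! ### The metric graph of a simple graph -/

open Classical in
/-- The points of a simple graph in which every edge is identified with the interval `[0,1]`.
The point of the edge `[u,v]` at distance `t` from `u` is recorded by its barycentric coordinates:
`1 - t` at `u`, `t` at `v` and `0` at all the other vertices. The vertex `u` itself (which may be
isolated) is the point with coordinate `1` at `u`. -/
@[ext]
structure MetricGraph {V : Type u} (G : SimpleGraph V) : Type u where
  coord : V → ℝ
  exists_edge : ∃ a b : V, (a = b ∨ G.Adj a b) ∧ ∃ t ∈ Set.Icc (0 : ℝ) 1,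
    coord = (1 - t) • Pi.single a (1 : ℝ) + t • Pi.single b (1 : ℝ)

namespace MetricGraph

variable {V : Type u} {G : SimpleGraph V}

/-- The point `x` lies on the closed edge `[a,b]` (for adjacent `a`, `b`). -/
def OnEdge (x : MetricGraph G) (a b : V) : Prop :=
  ∀ w, x.coord w ≠ 0 → w = a ∨ w = b

/-- The length of the shortest segment from `x` to `y` inside one closed edge
(`⊤` if no closed edge contains both). -/
noncomputable def edgeDist (x y : MetricGraph G) : ℝ≥0∞ :=
  ⨅ (a : V) (b : V) (_ : G.Adj a b) (_ : x.OnEdge a b) (_ : y.OnEdge a b),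
    ENNReal.ofReal |x.coord a - y.coord a|

open Classical in
/-- The distance from `x` to the vertex `a` along an edge whose interior contains `x`;
it is `0` if `x` is the vertex `a`, and `⊤` if `x` is another vertex or is not on an edge at `a`. -/
noncomputable def vertexDist (x : MetricGraph G) (a : V) : ℝ≥0∞ :=
  if 0 < x.coord a then ENNReal.ofReal (1 - x.coord a) else ⊤

/-- The length of a shortest path from `x` to `y`: such a path either stays in one closed edge, or
goes from `x` to a vertex `a`, along edges from `a` to a vertex `b`, and from `b` to `y`.
It is `⊤` if there is no path. -/
noncomputable def pathDist (x y : MetricGraph G) : ℝ≥0∞ :=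
  min (edgeDist x y)
    (⨅ (a : V) (b : V), vertexDist x a + (G.edist a b : ℝ≥0∞) + vertexDist y b)

theorem vertex_or_interior (x : MetricGraph G) :
    (∃ a, x.coord a = 1 ∧ ∀ w, w ≠ a → x.coord w = 0) ∨
    (∃ a b, G.Adj a b ∧ 0 < x.coord a ∧ 0 < x.coord b ∧ x.coord a + x.coord b = 1 ∧
      ∀ w, w ≠ a → w ≠ b → x.coord w = 0) := by
  classical
  obtain ⟨a, b, hab, t, ⟨ht0, ht1⟩, hx⟩ := x.exists_edge
  rcases hab with rfl | hab
  · left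
    refine ⟨a, by simp [hx], fun w hw => by simp [hx, hw]⟩
  · have hne := hab.ne
    have ha : x.coord a = 1 - t := by simp [hx, hne]
    have hb : x.coord b = t := by simp [hx, hne.symm]
    rcases ht0.eq_or_lt with rfl | h0
    · exact Or.inl ⟨a, by simp [ha], fun w hw => by simp [hx, hw]⟩
    rcases ht1.eq_or_lt with rfl | h1
    · exact Or.inl ⟨b, by simp [hb], fun w hw => by simp [hx, hw]⟩
    · refine Or.inr ⟨a, b, hab, by linarith, by linarith, by linarith, fun w h h' => ?_⟩
      simp [hx, h, h']

theorem coord_nonneg (x : MetricGraph G) (w : V) : 0 ≤ x.coord w := by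
  rcases x.vertex_or_interior with ⟨a, ha, h⟩ | ⟨a, b, -, ha, hb, hs, h⟩
  · by_cases hw : w = a
    · subst hw; linarith
    · exact (h w hw).ge
  · by_cases hw : w = a
    · subst hw; exact ha.le
    by_cases hw' : w = b
    · subst hw'; exact hb.le
    exact (h w hw hw').ge

theorem OnEdge.add_eq_one {x : MetricGraph G} {a b : V} (h : x.OnEdge a b) (hab : a ≠ b) :
    x.coord a + x.coord b = 1 := by
  rcases x.vertex_or_interior with ⟨c, hc, h'⟩ | ⟨c, d, hcd, hc, hd, hs, h'⟩
  · rcases h c (by linarith) with rfl | rfl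
    · rw [hc, h' b hab.symm]; ring
    · rw [hc, h' a hab]; ring
  · have hne := hcd.ne
    rcases h c hc.ne' with rfl | rfl <;> rcases h d hd.ne' with rfl | rfl
    · exact absurd rfl hne
    · exact hs
    · linarith
    · exact absurd rfl hne

theorem OnEdge.symm {x : MetricGraph G} {a b : V} (h : x.OnEdge a b) : x.OnEdge b a :=
  fun w hw => (h w hw).symm

theorem vertexDist_of_pos {x : MetricGraph G} {a : V} (h : 0 < x.coord a) :
    vertexDist x a = ENNReal.ofReal (1 - x.coord a) := by simp [vertexDist, h]

theorem vertexDist_of_not_pos {x : MetricGraph G} {a : V} (h : ¬ 0 < x.coord a) :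
    vertexDist x a = ⊤ := by simp [vertexDist, h]

theorem edist_le_vertexDist_add (x : MetricGraph G) (a b : V) :
    (G.edist a b : ℝ≥0∞) ≤ vertexDist x a + vertexDist x b := by
  by_cases ha : 0 < x.coord a
  swap
  · simp [vertexDist_of_not_pos ha]
  by_cases hb : 0 < x.coord b
  swap
  · simp [vertexDist_of_not_pos hb]
  by_cases hab : a = b
  · subst hab; simp
  rcases x.vertex_or_interior with ⟨c, hc, h'⟩ | ⟨c, d, hcd, hc, hd, hs, h'⟩
  · have h1 : a = c := by by_contra h; exact ha.ne' (h' a h)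
    have h2 : b = c := by by_contra h; exact hb.ne' (h' b h)
    exact absurd (h1.trans h2.symm) hab
  · have key : G.Adj a b ∧ x.coord a + x.coord b = 1 := by
      have h1 : a = c ∨ a = d := by
        by_contra h; push Not at h; exact ha.ne' (h' a h.1 h.2)
      have h2 : b = c ∨ b = d := by
        by_contra h; push Not at h; exact hb.ne' (h' b h.1 h.2)
      rcases h1 with rfl | rfl <;> rcases h2 with rfl | rfl
      · exact absurd rfl hab
      · exact ⟨hcd, hs⟩
      · exact ⟨hcd.symm, by linarith⟩
      · exact absurd rfl hab
    rw [vertexDist_of_pos ha, vertexDist_of_pos hb, SimpleGraph.edist_eq_one_iff_adj.2 key.1,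
      ← ENNReal.ofReal_add (by linarith) (by linarith)]
    have : 1 - x.coord a + (1 - x.coord b) = 1 := by linarith
    simp [this]

theorem pathDist_le_of_onEdge {x y : MetricGraph G} {a b : V} (hab : G.Adj a b)
    (hx : x.OnEdge a b) (hy : y.OnEdge a b) :
    pathDist x y ≤ ENNReal.ofReal |x.coord a - y.coord a| :=
  (min_le_left _ _).trans (iInf_le_of_le a <| iInf_le_of_le b <| iInf_le_of_le hab <|
    iInf_le_of_le hx <| iInf_le_of_le hy le_rfl)

theorem pathDist_le_via (x y : MetricGraph G) (a b : V) :
    pathDist x y ≤ vertexDist x a + (G.edist a b : ℝ≥0∞) + vertexDist y b :=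
  (min_le_right _ _).trans (iInf_le_of_le a <| iInf_le_of_le b le_rfl)

/-- A lower bound for both kinds of paths is a lower bound for the distance. -/
theorem le_pathDist {x y : MetricGraph G} {r : ℝ≥0∞}
    (h₁ : ∀ a b, G.Adj a b → x.OnEdge a b → y.OnEdge a b →
      r ≤ ENNReal.ofReal |x.coord a - y.coord a|)
    (h₂ : ∀ a b, r ≤ vertexDist x a + (G.edist a b : ℝ≥0∞) + vertexDist y b) :
    r ≤ pathDist x y :=
  le_min (le_iInf fun a => le_iInf fun b => le_iInf fun h => le_iInf fun hx => le_iInf fun hy =>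
    h₁ a b h hx hy) (le_iInf fun a => le_iInf fun b => h₂ a b)

theorem pathDist_comm_le (x y : MetricGraph G) : pathDist x y ≤ pathDist y x := by
  refine le_pathDist (fun a b h hy hx => ?_) (fun a b => ?_)
  · rw [abs_sub_comm]; exact pathDist_le_of_onEdge h hx hy
  · refine (pathDist_le_via x y b a).trans_eq ?_
    rw [SimpleGraph.edist_comm]; ring

theorem pathDist_comm (x y : MetricGraph G) : pathDist x y = pathDist y x :=
  le_antisymm (pathDist_comm_le x y) (pathDist_comm_le y x)

theorem pathDist_self (x : MetricGraph G) : pathDist x x = 0 := by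
  refine le_antisymm ?_ zero_le
  rcases x.vertex_or_interior with ⟨c, hc, -⟩ | ⟨c, d, hcd, -, -, -, h'⟩
  · refine (pathDist_le_via x x c c).trans ?_
    rw [vertexDist_of_pos (by linarith), hc]
    simp
  · have hx : x.OnEdge c d := fun w hw => by
      by_contra h; push Not at h; exact hw (h' w h.1 h.2)
    refine (pathDist_le_of_onEdge hcd hx hx).trans ?_
    simp

/-- Moving inside one edge before going to a vertex. -/
theorem exists_vertexDist_le {x y : MetricGraph G} {a b : V} (hab : G.Adj a b)
    (hx : x.OnEdge a b) (hy : y.OnEdge a b) (c : V) :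
    ∃ d, vertexDist x d + (G.edist d c : ℝ≥0∞) ≤
      ENNReal.ofReal |x.coord a - y.coord a| + vertexDist y c := by
  by_cases hc : 0 < y.coord c
  swap
  · exact ⟨c, by simp [vertexDist_of_not_pos hc]⟩
  wlog hca : c = a generalizing a b
  · have hcb : c = b := (hy c hc.ne').resolve_left hca
    obtain ⟨d, hd⟩ := this hab.symm hx.symm hy.symm hcb
    refine ⟨d, hd.trans_eq ?_⟩
    have h1 := hx.add_eq_one hab.ne
    have h2 := hy.add_eq_one hab.ne
    have : x.coord b - y.coord b = -(x.coord a - y.coord a) := by linarith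
    rw [this, abs_neg]
  subst hca
  have h1 := hx.add_eq_one hab.ne
  have h2 := hy.add_eq_one hab.ne
  have h3 := y.coord_nonneg b
  by_cases hxc : 0 < x.coord c
  · refine ⟨c, ?_⟩
    rw [vertexDist_of_pos hxc, vertexDist_of_pos hc, SimpleGraph.edist_self,
      ← ENNReal.ofReal_add (abs_nonneg _) (by linarith)]
    simp only [ENat.toENNReal_zero, add_zero]
    refine ENNReal.ofReal_le_ofReal ?_
    have := neg_abs_le (x.coord c - y.coord c)
    linarith
  · have hx0 : x.coord c = 0 := le_antisymm (not_lt.1 hxc) (x.coord_nonneg c)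
    refine ⟨b, ?_⟩
    rw [vertexDist_of_pos (by linarith), vertexDist_of_pos hc,
      SimpleGraph.edist_eq_one_iff_adj.2 hab.symm,
      ← ENNReal.ofReal_add (abs_nonneg _) (by linarith), hx0, zero_sub, abs_neg, abs_of_pos hc]
    have e1 : 1 - x.coord b = 0 := by linarith
    simp [e1]

theorem pathDist_triangle_edge {x y z : MetricGraph G} {a b : V} (hab : G.Adj a b)
    (hx : x.OnEdge a b) (hy : y.OnEdge a b) :
    pathDist x z ≤ ENNReal.ofReal |x.coord a - y.coord a| + pathDist y z := by
  have via : ∀ c d, pathDist x z ≤ ENNReal.ofReal |x.coord a - y.coord a| +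
      (vertexDist y c + (G.edist c d : ℝ≥0∞) + vertexDist z d) := by
    intro c d
    obtain ⟨e, he⟩ := exists_vertexDist_le hab hx hy c
    have ht : (G.edist e d : ℝ≥0∞) ≤ (G.edist e c : ℝ≥0∞) + (G.edist c d : ℝ≥0∞) := by
      rw [← ENat.toENNReal_add]
      exact ENat.toENNReal_le.2 SimpleGraph.edist_triangle
    calc pathDist x z ≤ vertexDist x e + (G.edist e d : ℝ≥0∞) + vertexDist z d :=
          pathDist_le_via x z e d
      _ ≤ vertexDist x e + ((G.edist e c : ℝ≥0∞) + (G.edist c d : ℝ≥0∞)) + vertexDist z d := by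
          gcongr
      _ = (vertexDist x e + (G.edist e c : ℝ≥0∞)) + ((G.edist c d : ℝ≥0∞) + vertexDist z d) := by
          ring
      _ ≤ (ENNReal.ofReal |x.coord a - y.coord a| + vertexDist y c) +
          ((G.edist c d : ℝ≥0∞) + vertexDist z d) := by gcongr
      _ = _ := by ring
  rw [pathDist.eq_1 y z, ← min_add_add_left]
  refine le_min ?_ ?_
  · simp only [edgeDist, ENNReal.add_iInf]
    refine le_iInf fun c => le_iInf fun d => le_iInf fun hcd => le_iInf fun hyc =>
      le_iInf fun hzc => ?_
    rcases y.vertex_or_interior with ⟨e, he, -⟩ | ⟨e, f, hef, he, hf, -, -⟩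
    · -- `y` is a vertex: go through it
      obtain ⟨k, hk⟩ := exists_vertexDist_le hcd.symm hzc.symm hyc.symm e
      have h0 : vertexDist y e = 0 := by rw [vertexDist_of_pos (by linarith), he]; simp
      refine (via e k).trans ?_
      gcongr
      have h1 := hyc.add_eq_one hcd.ne
      have h2 := hzc.add_eq_one hcd.ne
      have h3 : z.coord d - y.coord d = y.coord c - z.coord c := by linarith
      rw [h0, add_zero, h3] at hk
      rw [h0, zero_add, SimpleGraph.edist_comm, add_comm]
      exact hk
    · -- `y` is inside an edge: the two edges agree
      have hne := hef.ne
      have h1 := hx.add_eq_one hab.ne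
      have h2 := hy.add_eq_one hab.ne
      have hcase : (c = a ∧ d = b) ∨ (c = b ∧ d = a) := by
        have A := hy e he.ne'
        have B := hy f hf.ne'
        have C := hyc e he.ne'
        have D := hyc f hf.ne'
        grind
      rcases hcase with ⟨rfl, rfl⟩ | ⟨rfl, rfl⟩
      · refine (pathDist_le_of_onEdge hab hx hzc).trans ?_
        rw [← ENNReal.ofReal_add (abs_nonneg _) (abs_nonneg _)]
        exact ENNReal.ofReal_le_ofReal (abs_sub_le _ _ _)
      · refine (pathDist_le_of_onEdge hab.symm hx.symm hzc).trans ?_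
        have h3 : x.coord d - y.coord d = -(x.coord c - y.coord c) := by linarith
        rw [h3, abs_neg, ← ENNReal.ofReal_add (abs_nonneg _) (abs_nonneg _)]
        exact ENNReal.ofReal_le_ofReal (abs_sub_le _ _ _)
  · simp only [ENNReal.add_iInf]
    exact le_iInf fun c => le_iInf fun d => via c d

theorem pathDist_triangle (x y z : MetricGraph G) :
    pathDist x z ≤ pathDist x y + pathDist y z := by
  have edgeR : ∀ a b, G.Adj a b → y.OnEdge a b → z.OnEdge a b →
      pathDist x z ≤ pathDist x y + ENNReal.ofReal |y.coord a - z.coord a| := by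
    intro a b hab hy hz
    rw [pathDist_comm x z, pathDist_comm x y, add_comm, abs_sub_comm]
    exact pathDist_triangle_edge hab hz hy
  rw [pathDist.eq_1 y z, ← min_add_add_left]
  refine le_min ?_ ?_
  · simp only [edgeDist, ENNReal.add_iInf]
    exact le_iInf fun a => le_iInf fun b => le_iInf fun hab => le_iInf fun hy =>
      le_iInf fun hz => edgeR a b hab hy hz
  · simp only [ENNReal.add_iInf]
    refine le_iInf fun c => le_iInf fun d => ?_
    set R := vertexDist y c + (G.edist c d : ℝ≥0∞) + vertexDist z d with hR
    rw [pathDist.eq_1 x y, ← min_add_add_right]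
    refine le_min ?_ ?_
    · simp only [edgeDist, ENNReal.iInf_add]
      refine le_iInf fun a => le_iInf fun b => le_iInf fun hab => le_iInf fun hx =>
        le_iInf fun hy => ?_
      refine (pathDist_triangle_edge hab hx hy).trans ?_
      gcongr
      exact pathDist_le_via y z c d
    · simp only [ENNReal.iInf_add]
      refine le_iInf fun a => le_iInf fun b => ?_
      have ht : (G.edist a d : ℝ≥0∞) ≤
          (G.edist a b : ℝ≥0∞) + (G.edist b c : ℝ≥0∞) + (G.edist c d : ℝ≥0∞) := by
        rw [← ENat.toENNReal_add, ← ENat.toENNReal_add]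
        refine ENat.toENNReal_le.2 ((SimpleGraph.edist_triangle (v := c)).trans ?_)
        gcongr
        exact SimpleGraph.edist_triangle
      calc pathDist x z ≤ vertexDist x a + (G.edist a d : ℝ≥0∞) + vertexDist z d :=
            pathDist_le_via x z a d
        _ ≤ vertexDist x a + ((G.edist a b : ℝ≥0∞) + (vertexDist y b + vertexDist y c) +
            (G.edist c d : ℝ≥0∞)) + vertexDist z d := by
            gcongr
            refine ht.trans ?_
            gcongr
            exact edist_le_vertexDist_add y b c
        _ = _ := by rw [hR]; ring

theorem vertexDist_ne_zero_of_coord_ne_one {x : MetricGraph G} {a : V} (h : x.coord a < 1) :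
    vertexDist x a ≠ 0 := by
  by_cases ha : 0 < x.coord a
  · rw [vertexDist_of_pos ha]
    simpa using h
  · simp [vertexDist_of_not_pos ha]

theorem coord_lt_one_or_vertex (x : MetricGraph G) :
    (∃ a, x.coord a = 1 ∧ ∀ w, w ≠ a → x.coord w = 0) ∨
      ∃ r : ℝ≥0∞, r ≠ 0 ∧ ∀ a, r ≤ vertexDist x a := by
  rcases x.vertex_or_interior with h | ⟨c, d, hcd, hc, hd, hs, h'⟩
  · exact Or.inl h
  · refine Or.inr ⟨min (vertexDist x c) (vertexDist x d), ?_, fun a => ?_⟩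
    · have h1 := vertexDist_ne_zero_of_coord_ne_one (x := x) (a := c) (by linarith)
      have h2 := vertexDist_ne_zero_of_coord_ne_one (x := x) (a := d) (by linarith)
      exact (lt_min (pos_iff_ne_zero.2 h1) (pos_iff_ne_zero.2 h2)).ne'
    · by_cases h1 : a = c
      · subst h1; exact min_le_left _ _
      by_cases h2 : a = d
      · subst h2; exact min_le_right _ _
      rw [vertexDist_of_not_pos (a := a) (by rw [h' a h1 h2]; exact lt_irrefl _)]
      exact le_top

theorem eq_of_onEdge {x y : MetricGraph G} {a b : V} (hab : a ≠ b)
    (hx : x.OnEdge a b) (hy : y.OnEdge a b) (h : x.coord a = y.coord a) : x = y := by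
  ext w
  by_cases hw : w = a
  · rw [hw, h]
  by_cases hw' : w = b
  · have h1 := hx.add_eq_one hab
    have h2 := hy.add_eq_one hab
    rw [hw']; linarith
  · have h1 : x.coord w = 0 := by
      by_contra hh; rcases hx w hh with h | h <;> contradiction
    have h2 : y.coord w = 0 := by
      by_contra hh; rcases hy w hh with h | h <;> contradiction
    rw [h1, h2]

theorem eq_of_pathDist_eq_zero {x y : MetricGraph G} (h : pathDist x y = 0) : x = y := by
  by_contra hxy
  have hedge : ∀ a b, G.Adj a b → x.OnEdge a b → y.OnEdge a b → x.coord a ≠ y.coord a :=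
    fun a b hab hx hy hh => hxy (eq_of_onEdge hab.ne hx hy hh)
  -- a common positive lower bound for the distances inside edges
  obtain ⟨r, hr0, hr⟩ : ∃ r : ℝ≥0∞, r ≠ 0 ∧ ∀ a b, G.Adj a b → x.OnEdge a b → y.OnEdge a b →
      r ≤ ENNReal.ofReal |x.coord a - y.coord a| := by
    by_cases hex : ∃ a b, G.Adj a b ∧ x.OnEdge a b ∧ y.OnEdge a b
    · obtain ⟨a, b, hab, hx, hy⟩ := hex
      refine ⟨ENNReal.ofReal |x.coord a - y.coord a|, ?_, ?_⟩
      · simpa using sub_ne_zero.2 (hedge a b hab hx hy)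
      · intro c d hcd hx' hy'
        refine ENNReal.ofReal_le_ofReal (le_of_eq ?_)
        have h1 := hx.add_eq_one hab.ne
        have h2 := hy.add_eq_one hab.ne
        have hn : x.coord c ≠ 0 ∨ y.coord c ≠ 0 := by
          by_contra hh
          push Not at hh
          exact hedge c d hcd hx' hy' (hh.1.trans hh.2.symm)
        have hc : c = a ∨ c = b := hn.elim (hx c) (hy c)
        rcases hc with rfl | rfl
        · rfl
        · rw [← abs_neg]; congr 1; linarith
    · refine ⟨1, one_ne_zero, fun a b hab hx hy => absurd ⟨a, b, hab, hx, hy⟩ hex⟩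
  -- a positive lower bound for the paths through vertices
  obtain ⟨s, hs0, hs⟩ : ∃ s : ℝ≥0∞, s ≠ 0 ∧ ∀ a b,
      s ≤ vertexDist x a + (G.edist a b : ℝ≥0∞) + vertexDist y b := by
    rcases x.coord_lt_one_or_vertex with ⟨c, hc, hc'⟩ | ⟨s, hs0, hs⟩
    · rcases y.coord_lt_one_or_vertex with ⟨d, hd, hd'⟩ | ⟨s, hs0, hs⟩
      · have hcd : c ≠ d := by
          rintro rfl
          refine hxy (MetricGraph.ext (funext fun w => ?_))
          by_cases hw : w = c
          · rw [hw, hc, hd]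
          · rw [hc' w hw, hd' w hw]
        refine ⟨(G.edist c d : ℝ≥0∞), ?_, fun a b => ?_⟩
        · simpa using hcd
        · by_cases ha : a = c
          · by_cases hb : b = d
            · subst ha hb
              exact le_add_right (le_add_left le_rfl)
            · rw [vertexDist_of_not_pos (x := y) (by rw [hd' b hb]; exact lt_irrefl _)]
              simp
          · rw [vertexDist_of_not_pos (x := x) (by rw [hc' a ha]; exact lt_irrefl _)]
            simp
      · exact ⟨s, hs0, fun a b => le_add_left (hs b)⟩
    · exact ⟨s, hs0, fun a b => le_add_right (le_add_right (hs a))⟩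
  have := le_pathDist (r := min r s)
    (fun a b hab hx hy => (min_le_left _ _).trans (hr a b hab hx hy))
    (fun a b => (min_le_right _ _).trans (hs a b))
  rw [h] at this
  exact (lt_min (pos_iff_ne_zero.2 hr0) (pos_iff_ne_zero.2 hs0)).not_ge this

/-- A graph with edges of length `1`, with the distance given by the lengths of shortest paths
(infinite between different connected components). -/
noncomputable instance : EMetricSpace (MetricGraph G) where
  edist := pathDist
  edist_self := pathDist_self
  edist_comm := pathDist_comm
  edist_triangle := pathDist_triangle
  eq_of_edist_eq_zero := eq_of_pathDist_eq_zero

theorem edist_def (x y : MetricGraph G) : edist x y = pathDist x y := rfl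

end MetricGraph

/-! ### Geodesics and the hyperbolicity constant -/

/-- `S` is (the image of) a geodesic `[xy]` of `X`, parametrized by arc length. -/
def IsGeodesicSegment {X : Type u} [EMetricSpace X] (x y : X) (S : Set X) : Prop :=
  ∃ (L : ℝ) (γ : ℝ → X), 0 ≤ L ∧ γ 0 = x ∧ γ L = y ∧
    (∀ s ∈ Set.Icc 0 L, ∀ t ∈ Set.Icc 0 L, edist (γ s) (γ t) = ENNReal.ofReal |s - t|) ∧
    γ '' Set.Icc 0 L = S

/-- A geodesic triangle `{x₁, x₂, x₃}` of `X`: three points together with a choice of geodesics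
`[x₁x₂]`, `[x₂x₃]`, `[x₃x₁]`. -/
structure GeodesicTriangle (X : Type u) [EMetricSpace X] where
  x₁ : X
  x₂ : X
  x₃ : X
  side₁₂ : Set X
  side₂₃ : Set X
  side₃₁ : Set X
  isGeodesic₁₂ : IsGeodesicSegment x₁ x₂ side₁₂
  isGeodesic₂₃ : IsGeodesicSegment x₂ x₃ side₂₃
  isGeodesic₃₁ : IsGeodesicSegment x₃ x₁ side₃₁

namespace GeodesicTriangle

variable {X : Type u} [EMetricSpace X]

/-- The union of the three sides. -/
def carrier (T : GeodesicTriangle X) : Set X := T.side₁₂ ∪ T.side₂₃ ∪ T.side₃₁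

/-- Every point of a side is at distance at most `δ` from the union of the two other sides. -/
def IsThin (T : GeodesicTriangle X) (δ : ℝ≥0) : Prop :=
  (∀ p ∈ T.side₁₂, Metric.infEDist p (T.side₂₃ ∪ T.side₃₁) ≤ δ) ∧
  (∀ p ∈ T.side₂₃, Metric.infEDist p (T.side₃₁ ∪ T.side₁₂) ≤ δ) ∧
  (∀ p ∈ T.side₃₁, Metric.infEDist p (T.side₁₂ ∪ T.side₂₃) ≤ δ)

/-- The sharp thin constant `δ(T)`. -/
noncomputable def thinConst (T : GeodesicTriangle X) : ℝ≥0∞ :=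
  ⨅ (δ : ℝ≥0) (_ : T.IsThin δ), (δ : ℝ≥0∞)

end GeodesicTriangle

/-- The hyperbolicity constant of a subset `S` of `X`: the supremum of `δ(T)` over the geodesic
triangles `T` of `X` contained in `S`. -/
noncomputable def hyperbolicityConstOn {X : Type u} [EMetricSpace X] (S : Set X) : ℝ≥0∞ :=
  ⨆ (T : GeodesicTriangle X) (_ : T.carrier ⊆ S), T.thinConst

/-- The hyperbolicity constant `δ(X)`: the supremum of the hyperbolicity constants of the
connected components of `X`. -/
noncomputable def hyperbolicityConst (X : Type u) [EMetricSpace X] : ℝ≥0∞ :=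
  ⨆ x : X, hyperbolicityConstOn (connectedComponent x)

theorem IsGeodesicSegment.subset_connectedComponent {X : Type u} [EMetricSpace X] {x y : X}
    {S : Set X} (h : IsGeodesicSegment x y S) :
    S ⊆ connectedComponent x ∧ x ∈ S ∧ y ∈ S := by
  obtain ⟨L, γ, hL, h0, h1, hγ, rfl⟩ := h
  have hx : x ∈ γ '' Set.Icc 0 L := ⟨0, ⟨le_rfl, hL⟩, h0⟩
  refine ⟨?_, hx, ⟨L, ⟨hL, le_rfl⟩, h1⟩⟩
  have hc : ContinuousOn γ (Set.Icc 0 L) := by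
    have : LipschitzOnWith 1 γ (Set.Icc 0 L) := fun s hs t ht => by
      rw [hγ s hs t ht, edist_dist, Real.dist_eq]; simp
    exact this.continuousOn
  exact (isPreconnected_Icc.image γ hc).subset_connectedComponent hx

/-- Geodesic triangles are connected, so all of them are taken into account. -/
theorem hyperbolicityConst_eq_iSup (X : Type u) [EMetricSpace X] :
    hyperbolicityConst X = ⨆ T : GeodesicTriangle X, T.thinConst := by
  refine le_antisymm ?_ ?_
  · exact iSup_le fun x => iSup_le fun T => iSup_le fun _ => le_iSup (fun T => T.thinConst) T
  · refine iSup_le fun T => ?_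
    have h12 := T.isGeodesic₁₂.subset_connectedComponent
    have h23 := T.isGeodesic₂₃.subset_connectedComponent
    have h31 := T.isGeodesic₃₁.subset_connectedComponent
    have e2 : connectedComponent T.x₁ = connectedComponent T.x₂ :=
      connectedComponent_eq (h12.1 h12.2.2)
    have e3 : connectedComponent T.x₃ = connectedComponent T.x₁ :=
      connectedComponent_eq (h31.1 h31.2.2)
    have hsub : T.carrier ⊆ connectedComponent T.x₁ := by
      refine Set.union_subset (Set.union_subset h12.1 ?_) ?_
      · rw [e2]; exact h23.1
      · rw [← e3]; exact h31.1
    exact le_iSup_of_le T.x₁ (le_iSup_of_le T (le_iSup_of_le hsub le_rfl))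

namespace SimpleGraph

/-- The hyperbolicity constant `δ(G)` of a simple graph whose edges have length `1`. -/
noncomputable def hyperbolicity {V : Type u} (G : SimpleGraph V) : ℝ≥0∞ :=
  hyperbolicityConst (MetricGraph G)

/-- The graph join: the disjoint union of `G₁` and `G₂` together with all the edges between
a vertex of `G₁` and a vertex of `G₂`. -/
def graphJoin {V₁ : Type u} {V₂ : Type v} (G₁ : SimpleGraph V₁) (G₂ : SimpleGraph V₂) :
    SimpleGraph (V₁ ⊕ V₂) :=
  (G₁ ⊕g G₂) ⊔ completeBipartiteGraph V₁ V₂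

end SimpleGraph

/-! ### Hyperbolicity and the diameters of the components -/

/-! Write `H` for either factor. In the join, `H` is an induced subgraph all of whose vertices are
adjacent to one vertex `v`, taken from the other factor. It suffices to bound the hyperbolicity of
the join below by `min (5/4) δ(H)`, and short cycles through `v` do this.

Lower bounds come from bigons. Two antipodal points cut an `n`-cycle into arcs of length `n/2`; if
both arcs are geodesics and the middle of one is at distance `n/4` from the other, then the constant
is at least `n/4`. This is applied to cycles of length 3, 4 and 5
(`three_quarters_le_hyperbolicity`, `one_le_hyperbolicity`, `five_quarters_le_hyperbolicity`).

Upper bounds come from diameters: a point of a side is within half the length of that side from one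
of its endpoints, and these lie on the other sides (`hyperbolicityConst_le_of_edist_le`).

If `H` has a path `w u x y` with `w` adjacent to neither `x` nor `y`, then `v` closes it to a
5-cycle and the bound is `5/4`. Otherwise the components of `H` have diameter at most 2, so `δ(H) ≤
1`, and three vertices `a b c` of a path close to a 4-cycle, of bound 1. Without such a path the
components are edges and vertices, so `δ(H) ≤ 1/2`, and an edge closes to a triangle, of bound
`3/4`. Without edges, `δ(H) = 0`. -/

section Diameter

variable {X : Type u} [EMetricSpace X]

theorem IsGeodesicSegment.left_mem {x y : X} {S : Set X} (h : IsGeodesicSegment x y S) : x ∈ S :=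
  h.subset_connectedComponent.2.1

theorem IsGeodesicSegment.right_mem {x y : X} {S : Set X} (h : IsGeodesicSegment x y S) : y ∈ S :=
  h.subset_connectedComponent.2.2

/-- A point of a geodesic is close to one of the endpoints. -/
theorem IsGeodesicSegment.edist_endpoint_le {D : ℝ≥0}
    (hD : ∀ p q : X, edist p q ≠ ⊤ → edist p q ≤ D) {x y p : X} {S : Set X}
    (h : IsGeodesicSegment x y S) (hp : p ∈ S) :
    edist p x ≤ (D / 2 : ℝ≥0) ∨ edist p y ≤ (D / 2 : ℝ≥0) := by
  obtain ⟨L, γ, hL, rfl, rfl, hγ, rfl⟩ := h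
  obtain ⟨s, hs, rfl⟩ := hp
  have h0 : (0 : ℝ) ∈ Set.Icc 0 L := ⟨le_rfl, hL⟩
  have h1 : L ∈ Set.Icc 0 L := ⟨hL, le_rfl⟩
  have hLD : L ≤ D := by
    have e := hγ 0 h0 L h1
    have := hD (γ 0) (γ L) (by rw [e]; exact ENNReal.ofReal_ne_top)
    rw [e, zero_sub, abs_neg, abs_of_nonneg hL] at this
    simpa using ENNReal.ofReal_le_iff_le_toReal ENNReal.coe_ne_top |>.1 this
  have key : ∀ r : ℝ, r ≤ D / 2 → ENNReal.ofReal r ≤ (D / 2 : ℝ≥0) := fun r hr => by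
    rw [ENNReal.ofReal_le_iff_le_toReal ENNReal.coe_ne_top]
    simpa using hr
  rcases le_total s (L / 2) with h | h
  · left
    rw [hγ s hs 0 h0]
    refine key _ ?_
    rw [sub_zero, abs_of_nonneg hs.1]
    linarith
  · right
    rw [hγ s hs L h1]
    refine key _ ?_
    rw [abs_sub_comm, abs_of_nonneg (by linarith [hs.2])]
    linarith

/-- The hyperbolicity constant is at most half of the diameter of the components. -/
theorem hyperbolicityConst_le_of_edist_le {D : ℝ≥0}
    (hD : ∀ p q : X, edist p q ≠ ⊤ → edist p q ≤ D) :
    hyperbolicityConst X ≤ (D / 2 : ℝ≥0) := by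
  rw [hyperbolicityConst_eq_iSup]
  refine iSup_le fun T => iInf₂_le_of_le (D / 2) ?_ le_rfl
  -- Each endpoint of a side is shared with one of the two other sides.
  have main : ∀ {x y : X} {S A B : Set X}, IsGeodesicSegment x y S → y ∈ A → x ∈ B →
      ∀ p ∈ S, Metric.infEDist p (A ∪ B) ≤ (D / 2 : ℝ≥0) := by
    intro x y S A B hS hy hx p hp
    rcases hS.edist_endpoint_le hD hp with h | h
    · exact (Metric.infEDist_le_edist_of_mem (Set.mem_union_right A hx)).trans h
    · exact (Metric.infEDist_le_edist_of_mem (Set.mem_union_left B hy)).trans h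
  exact ⟨main T.isGeodesic₁₂ T.isGeodesic₂₃.left_mem T.isGeodesic₃₁.right_mem,
    main T.isGeodesic₂₃ T.isGeodesic₃₁.left_mem T.isGeodesic₁₂.right_mem,
    main T.isGeodesic₃₁ T.isGeodesic₁₂.left_mem T.isGeodesic₂₃.right_mem⟩

/-! ### Bigons, and geodesics glued from 1-Lipschitz curves -/

theorem isGeodesicSegment_singleton (x : X) : IsGeodesicSegment x x {x} := by
  refine ⟨0, fun _ => x, le_rfl, rfl, rfl, fun s hs t ht => ?_, by simp⟩
  have h1 : s = 0 := le_antisymm hs.2 hs.1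
  have h2 : t = 0 := le_antisymm ht.2 ht.1
  simp [h1, h2]

/-- Two geodesics with the same endpoints bound the hyperbolicity constant from below. -/
theorem le_hyperbolicityConst_of_bigon {x y p : X} {S S' : Set X} {r : ℝ≥0∞}
    (hS : IsGeodesicSegment x y S) (hS' : IsGeodesicSegment y x S') (hp : p ∈ S)
    (hr : ∀ q ∈ S', r ≤ edist p q) : r ≤ hyperbolicityConst X := by
  rw [hyperbolicityConst_eq_iSup]
  -- A bigon is a triangle with the vertex `y` repeated; its degenerate side `{y}` is already
  -- contained in `S'`.
  refine le_iSup_of_le ⟨x, y, y, S, {y}, S', hS, isGeodesicSegment_singleton y, hS'⟩ ?_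
  refine le_iInf₂ fun δ hδ => le_trans ?_ (hδ.1 p hp)
  refine Metric.le_infEDist.2 fun q hq => ?_
  rcases hq with hq | hq
  · rw [Set.mem_singleton_iff.1 hq]
    exact hr _ hS'.left_mem
  · exact hr _ hq

/-- `S` is the image of a `1`-Lipschitz curve from `x` to `y` defined on `[0,L]`. -/
def IsCurveOfLength (L : ℝ) (x y : X) (S : Set X) : Prop :=
  ∃ γ : ℝ → X, 0 ≤ L ∧ γ 0 = x ∧ γ L = y ∧
    (∀ s t, 0 ≤ s → s ≤ t → t ≤ L → edist (γ s) (γ t) ≤ ENNReal.ofReal (t - s)) ∧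
    γ '' Set.Icc 0 L = S

theorem IsCurveOfLength.trans {L M : ℝ} {x y z : X} {S T : Set X}
    (h : IsCurveOfLength L x y S) (h' : IsCurveOfLength M y z T) :
    IsCurveOfLength (L + M) x z (S ∪ T) := by
  obtain ⟨γ, hL, rfl, hy, hγ, rfl⟩ := h
  obtain ⟨η, hM, rfl, rfl, hη, rfl⟩ := h'
  have hlow : ∀ s, s ≤ L → (if s ≤ L then γ s else η (s - L)) = γ s := fun s hs => if_pos hs
  have hhigh : ∀ s, L ≤ s → (if s ≤ L then γ s else η (s - L)) = η (s - L) := fun s hs => by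
    split_ifs with h
    · rw [le_antisymm h hs, hy, sub_self]
    · rfl
  refine ⟨fun s => if s ≤ L then γ s else η (s - L), by linarith, hlow 0 hL, ?_, ?_, ?_⟩
  · simp only
    rw [hhigh _ (by linarith), add_sub_cancel_left]
  · intro s t hs hst ht
    simp only
    rcases le_total t L with h1 | h1
    · rw [hlow s (hst.trans h1), hlow t h1]
      exact hγ s t hs hst h1
    rcases le_total L s with h2 | h2
    · rw [hhigh s h2, hhigh t h1]
      refine (hη _ _ (by linarith) (by linarith) (by linarith)).trans_eq ?_
      congr 1; ring
    · rw [hlow s h2, hhigh t h1]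
      have e1 := hγ s L hs h2 le_rfl
      have e2 := hη 0 (t - L) le_rfl (by linarith) (by linarith)
      rw [hy] at e1
      refine (edist_triangle _ (η 0) _).trans ((add_le_add e1 e2).trans_eq ?_)
      rw [← ENNReal.ofReal_add (by linarith) (by linarith)]
      congr 1; ring
  · ext q
    constructor
    · rintro ⟨s, hs, rfl⟩
      simp only
      rcases le_total s L with h1 | h1
      · rw [hlow s h1]; exact Or.inl ⟨s, ⟨hs.1, h1⟩, rfl⟩
      · rw [hhigh s h1]; exact Or.inr ⟨s - L, ⟨by linarith, by linarith [hs.2]⟩, rfl⟩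
    · rintro (⟨s, hs, rfl⟩ | ⟨s, hs, rfl⟩)
      · exact ⟨s, ⟨hs.1, by linarith [hs.2]⟩, hlow s hs.2⟩
      · refine ⟨s + L, ⟨by linarith [hs.1], by linarith [hs.2]⟩, ?_⟩
        simp only
        rw [hhigh _ (by linarith [hs.1]), add_sub_cancel_right]

/-- A curve which is not longer than the distance of its endpoints is a geodesic. -/
theorem IsCurveOfLength.isGeodesicSegment {L : ℝ} {x y : X} {S : Set X}
    (h : IsCurveOfLength L x y S) (hxy : ENNReal.ofReal L ≤ edist x y) :
    IsGeodesicSegment x y S := by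
  obtain ⟨γ, hL, rfl, rfl, hγ, rfl⟩ := h
  have key : ∀ s t, 0 ≤ s → s ≤ t → t ≤ L → edist (γ s) (γ t) = ENNReal.ofReal (t - s) := by
    intro s t hs hst ht
    refine le_antisymm (hγ s t hs hst ht) ?_
    -- The outer pieces contribute at most `s` and `L - t` to a distance of at least `L`, so the
    -- middle piece contributes at least `t - s`.
    have e1 := hγ 0 s le_rfl hs (hst.trans ht)
    have e2 := hγ t L (hs.trans hst) ht le_rfl
    have e3 := (edist_triangle (γ 0) (γ s) (γ L)).trans
      (add_le_add le_rfl (edist_triangle (γ s) (γ t) (γ L)))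
    have e4 := hxy.trans (e3.trans (add_le_add e1 (add_le_add le_rfl e2)))
    have hfin : edist (γ s) (γ t) ≠ ⊤ := ne_top_of_le_ne_top ENNReal.ofReal_ne_top (hγ s t hs hst ht)
    rw [← ENNReal.ofReal_toReal hfin, ← ENNReal.ofReal_add ENNReal.toReal_nonneg (by linarith),
      ← ENNReal.ofReal_add (by linarith) (by have := @ENNReal.toReal_nonneg (edist (γ s) (γ t));
                                             linarith),
      ENNReal.ofReal_le_ofReal_iff (by have := @ENNReal.toReal_nonneg (edist (γ s) (γ t));
                                       linarith)] at e4
    rw [← ENNReal.ofReal_toReal hfin]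
    exact ENNReal.ofReal_le_ofReal (by linarith)
  refine ⟨L, γ, hL, rfl, rfl, fun s hs t ht => ?_, rfl⟩
  rcases le_total s t with h | h
  · rw [key s t hs.1 h ht.2, abs_sub_comm, abs_of_nonneg (by linarith)]
  · rw [edist_comm, key t s ht.1 h hs.2, abs_of_nonneg (by linarith)]

end Diameter

/-! ### Points of edges -/

namespace MetricGraph

variable {V : Type u} {G : SimpleGraph V}

open Classical in
/-- The point of the edge `[a,b]` at distance `t` from `a` (for `t` in `[0,1]`). -/
noncomputable def edgePoint {a b : V} (hab : G.Adj a b) (t : ℝ) : MetricGraph G where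
  -- Clamping the parameter makes the point defined for every real `t`.
  coord := (1 - (Set.projIcc 0 1 zero_le_one t : ℝ)) • Pi.single a (1 : ℝ) +
    (Set.projIcc 0 1 zero_le_one t : ℝ) • Pi.single b (1 : ℝ)
  exists_edge := ⟨a, b, Or.inr hab, _, (Set.projIcc (0 : ℝ) 1 zero_le_one t).2, rfl⟩

section

variable {a b : V} (hab : G.Adj a b) {t : ℝ}

theorem edgePoint_onEdge (t : ℝ) : (edgePoint hab t).OnEdge a b := by
  intro w hw
  by_contra! h
  simp [edgePoint, h.1, h.2] at hw

theorem edgePoint_coord_left (h0 : 0 ≤ t) (h1 : t ≤ 1) : (edgePoint hab t).coord a = 1 - t := by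
  simp [edgePoint, Set.projIcc_of_mem zero_le_one ⟨h0, h1⟩, hab.ne]

theorem edgePoint_coord_right (h0 : 0 ≤ t) (h1 : t ≤ 1) : (edgePoint hab t).coord b = t := by
  simp [edgePoint, Set.projIcc_of_mem zero_le_one ⟨h0, h1⟩, hab.ne.symm]

/-- The vertex `b` does not depend on the edge. -/
theorem edgePoint_one_eq {c : V} (hbc : G.Adj b c) : edgePoint hab 1 = edgePoint hbc 0 := by
  ext w
  simp [edgePoint]

theorem isCurveOfLength_edgePoint {s : ℝ} (h0 : 0 ≤ s) (hst : s ≤ t) (h1 : t ≤ 1) :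
    IsCurveOfLength (t - s) (edgePoint hab s) (edgePoint hab t) (edgePoint hab '' Set.Icc s t) := by
  refine ⟨fun r => edgePoint hab (s + r), by linarith, by simp, by simp, ?_, ?_⟩
  · intro p q hp hpq hq
    rw [edist_def]
    refine (pathDist_le_of_onEdge hab (edgePoint_onEdge _ _) (edgePoint_onEdge _ _)).trans_eq ?_
    rw [edgePoint_coord_left _ (by linarith) (by linarith),
      edgePoint_coord_left _ (by linarith) (by linarith), abs_of_nonneg (by linarith)]
    congr 1; ring
  · ext q
    constructor
    · rintro ⟨r, hr, rfl⟩
      exact ⟨s + r, ⟨by linarith [hr.1], by linarith [hr.2]⟩, rfl⟩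
    · rintro ⟨r, hr, rfl⟩
      exact ⟨r - s, ⟨by linarith [hr.1], by linarith [hr.2]⟩, by simp⟩

end

/-! ### Lower bounds for distances between points of different edges -/

open Classical in
/-- The distance of two vertices, truncated at `2`. -/
noncomputable def truncDist (G : SimpleGraph V) (a b : V) : ℝ :=
  if a = b then 0 else if G.Adj a b then 1 else 2

theorem truncDist_nonneg (a b : V) : 0 ≤ truncDist G a b := by
  unfold truncDist; split_ifs <;> norm_num

theorem truncDist_of_adj {a b : V} (h : G.Adj a b) : truncDist G a b = 1 := by
  simp [truncDist, h, h.ne]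

theorem one_le_truncDist {a b : V} (h : a ≠ b) : 1 ≤ truncDist G a b := by
  unfold truncDist; split_ifs <;> norm_num; exact h ‹_›

theorem truncDist_of_not_adj {a b : V} (h : a ≠ b) (h' : ¬ G.Adj a b) : truncDist G a b = 2 := by
  simp [truncDist, h, h']

theorem ofReal_truncDist_le (a b : V) : ENNReal.ofReal (truncDist G a b) ≤ (G.edist a b : ℝ≥0∞) := by
  unfold truncDist
  split_ifs with h h'
  · simp
  · simp [SimpleGraph.edist_eq_one_iff_adj.2 h']
  · have h2 : 2 ≤ G.edist a b := by
      by_contra! hlt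
      have h0 : G.edist a b ≠ 0 := by simpa using h
      have h1 : G.edist a b ≠ 1 := by simpa using h'
      have hle : G.edist a b ≤ 1 := Order.le_of_lt_add_one (by simpa [one_add_one_eq_two] using hlt)
      rcases Order.le_one_iff.1 hle with h | h
      · exact h0 h
      · exact h1 h
    have := ENat.toENNReal_le.2 h2
    simpa using this

/-- If an endpoint is a vertex, the paths inside an edge need not be considered. -/
theorem le_pathDist_of_vertex {x y : MetricGraph G} {r : ℝ≥0∞} {c : V} (hc : x.coord c = 1)
    (h : ∀ a b, r ≤ vertexDist x a + (G.edist a b : ℝ≥0∞) + vertexDist y b) : r ≤ pathDist x y := by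
  -- A segment that ends at the vertex `c` is at least as long as some path through `c`, to which
  -- `h` applies.
  refine le_pathDist (fun a b hab hx hy => ?_) h
  obtain ⟨d, hd⟩ := exists_vertexDist_le hab hy hx c
  have h0 : vertexDist x c = 0 := by rw [vertexDist_of_pos (by linarith), hc]; simp
  rw [h0, add_zero, abs_sub_comm] at hd
  refine (h c d).trans (le_trans (le_of_eq ?_) hd)
  rw [h0, SimpleGraph.edist_comm]; ring

/-- Points of different edges are joined by paths through the endpoints of the edges. -/
theorem le_pathDist_of_ne {x y : MetricGraph G} {r : ℝ≥0∞} {a b c d : V}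
    (hx : x.OnEdge a b) (hy : y.OnEdge c d) (hne : s(a, b) ≠ s(c, d))
    (h : ∀ a b, r ≤ vertexDist x a + (G.edist a b : ℝ≥0∞) + vertexDist y b) : r ≤ pathDist x y := by
  rcases x.vertex_or_interior with ⟨e, he, -⟩ | ⟨e, f, hef, he, hf, -, -⟩
  · exact le_pathDist_of_vertex he h
  rcases y.vertex_or_interior with ⟨e', he', -⟩ | ⟨e', f', hef', he', hf', -, -⟩
  · rw [pathDist_comm]
    refine le_pathDist_of_vertex he' fun a b => (h b a).trans_eq ?_
    rw [SimpleGraph.edist_comm]; ring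
  -- Both points are now interior, and an interior point determines its edge; one edge `kl`
  -- containing both would force `ab` and `cd` to coincide.
  refine le_pathDist (fun k l hkl hxk hyk => absurd ?_ hne) h
  have n1 := hef.ne
  have n2 := hef'.ne
  have a1 := hx e he.ne'
  have a2 := hx f hf.ne'
  have a3 := hy e' he'.ne'
  have a4 := hy f' hf'.ne'
  have a5 := hxk e he.ne'
  have a6 := hxk f hf.ne'
  have a7 := hyk e' he'.ne'
  have a8 := hyk f' hf'.ne'
  rw [Sym2.eq_iff]
  grind

/-- A path between different edges leaves the first through an endpoint and enters the second
through an endpoint, which gives four cases. Truncated distances bound the middle part from below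
and turn each case into a linear inequality between reals. -/
theorem le_edist_edgePoint {a b c d : V} (hab : G.Adj a b) (hcd : G.Adj c d) {s t r : ℝ}
    (hs0 : 0 ≤ s) (hs1 : s ≤ 1) (ht0 : 0 ≤ t) (ht1 : t ≤ 1) (hne : s(a, b) ≠ s(c, d))
    (h₁ : r ≤ s + truncDist G a c + t) (h₂ : r ≤ s + truncDist G a d + (1 - t))
    (h₃ : r ≤ 1 - s + truncDist G b c + t) (h₄ : r ≤ 1 - s + truncDist G b d + (1 - t)) :
    ENNReal.ofReal r ≤ edist (edgePoint hab s) (edgePoint hcd t) := by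
  rw [edist_def]
  refine le_pathDist_of_ne (edgePoint_onEdge _ _) (edgePoint_onEdge _ _) hne fun e f => ?_
  by_cases he : 0 < (edgePoint hab s).coord e
  swap
  · simp [vertexDist_of_not_pos he]
  by_cases hf : 0 < (edgePoint hcd t).coord f
  swap
  · simp [vertexDist_of_not_pos hf]
  rw [vertexDist_of_pos he, vertexDist_of_pos hf]
  have key : r ≤ 1 - (edgePoint hab s).coord e + truncDist G e f +
      (1 - (edgePoint hcd t).coord f) := by
    rcases edgePoint_onEdge hab s e he.ne' with rfl | rfl <;>
    rcases edgePoint_onEdge hcd t f hf.ne' with rfl | rfl <;>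
    simp only [edgePoint_coord_left _ hs0 hs1, edgePoint_coord_right _ hs0 hs1,
      edgePoint_coord_left _ ht0 ht1, edgePoint_coord_right _ ht0 ht1] <;> linarith
  have l1 : (edgePoint hab s).coord e ≤ 1 := by
    rcases edgePoint_onEdge hab s e he.ne' with rfl | rfl <;>
    simp only [edgePoint_coord_left _ hs0 hs1, edgePoint_coord_right _ hs0 hs1] <;> linarith
  have l2 : (edgePoint hcd t).coord f ≤ 1 := by
    rcases edgePoint_onEdge hcd t f hf.ne' with rfl | rfl <;>
    simp only [edgePoint_coord_left _ ht0 ht1, edgePoint_coord_right _ ht0 ht1] <;> linarith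
  have l3 := truncDist_nonneg (G := G) e f
  refine (ENNReal.ofReal_le_ofReal key).trans ?_
  rw [ENNReal.ofReal_add (by linarith) (by linarith), ENNReal.ofReal_add (by linarith) l3]
  gcongr
  exact ofReal_truncDist_le e f

/-! ### Lower bounds for the hyperbolicity constant -/

/-- The bigon joins `v` to the midpoint of `ab`. The middle of the arc through `a` is on `va`, at
distance `3/4` from `v`. -/
theorem three_quarters_le_hyperbolicity {v a b : V} (hva : G.Adj v a) (hab : G.Adj a b)
    (hbv : G.Adj b v) : ENNReal.ofReal (3 / 4) ≤ G.hyperbolicity := by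
  have c1 := isCurveOfLength_edgePoint hva (s := 0) (t := 1) le_rfl zero_le_one le_rfl
  have c2 := isCurveOfLength_edgePoint hab (s := 0) (t := 1 / 2) le_rfl (by norm_num) (by norm_num)
  have c3 := isCurveOfLength_edgePoint hab (s := 1 / 2) (t := 1) (by norm_num) (by norm_num) le_rfl
  have c4 := isCurveOfLength_edgePoint hbv (s := 0) (t := 1) le_rfl zero_le_one le_rfl
  -- The end of each edge is rewritten as the start of the next, so that the curves can be
  -- concatenated.
  rw [edgePoint_one_eq hva hab] at c1
  rw [edgePoint_one_eq hab hbv] at c3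
  rw [edgePoint_one_eq hbv hva] at c4
  have d1 := truncDist_of_adj hva
  have d2 := truncDist_of_adj hab
  have d3 := truncDist_of_adj hbv
  have d1' := truncDist_of_adj hva.symm
  have d2' := truncDist_of_adj hab.symm
  have d3' := truncDist_of_adj hbv.symm
  have n1 := hva.ne
  have n2 := hab.ne
  have n3 := hbv.ne
  have hd : ENNReal.ofReal (3 / 2) ≤ edist (edgePoint hva 0) (edgePoint hab (1 / 2)) := by
    refine le_edist_edgePoint _ _ ?_ ?_ ?_ ?_ ?_ ?_ ?_ ?_ ?_ <;>
      first
      | (rw [Ne, Sym2.eq_iff]; grind)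
      | linarith [truncDist_nonneg (G := G) a a]
  refine le_hyperbolicityConst_of_bigon (p := edgePoint hva (3 / 4))
    ((c1.trans c2).isGeodesicSegment (by convert hd using 2; norm_num))
    ((c3.trans c4).isGeodesicSegment (by rw [edist_comm]; convert hd using 2; norm_num))
    (Or.inl ⟨3 / 4, ⟨by norm_num, by norm_num⟩, rfl⟩) ?_
  rintro q (⟨t, ht, rfl⟩ | ⟨t, ht, rfl⟩) <;> obtain ⟨ht0, ht1⟩ := ht <;>
  refine le_edist_edgePoint _ _ ?_ ?_ ?_ ?_ ?_ ?_ ?_ ?_ ?_ <;>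
      first
      | (rw [Ne, Sym2.eq_iff]; grind)
      | linarith [truncDist_nonneg (G := G) a a, truncDist_nonneg (G := G) v v]

/-- The bigon joins the midpoints of the opposite sides `ab` and `cv`. Chords `ac` and `bv` are
harmless: all that matters is that these diagonals have length at least 1. -/
theorem one_le_hyperbolicity {a b c v : V} (hab : G.Adj a b) (hbc : G.Adj b c) (hcv : G.Adj c v)
    (hva : G.Adj v a) (hac : a ≠ c) (hbv : b ≠ v) : ENNReal.ofReal 1 ≤ G.hyperbolicity := by
  have c1 := isCurveOfLength_edgePoint hab (s := 1 / 2) (t := 1) (by norm_num) (by norm_num) le_rfl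
  have c2 := isCurveOfLength_edgePoint hbc (s := 0) (t := 1) le_rfl zero_le_one le_rfl
  have c3 := isCurveOfLength_edgePoint hcv (s := 0) (t := 1 / 2) le_rfl (by norm_num) (by norm_num)
  have c4 := isCurveOfLength_edgePoint hcv (s := 1 / 2) (t := 1) (by norm_num) (by norm_num) le_rfl
  have c5 := isCurveOfLength_edgePoint hva (s := 0) (t := 1) le_rfl zero_le_one le_rfl
  have c6 := isCurveOfLength_edgePoint hab (s := 0) (t := 1 / 2) le_rfl (by norm_num) (by norm_num)
  rw [edgePoint_one_eq hab hbc] at c1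
  rw [edgePoint_one_eq hbc hcv] at c2
  rw [edgePoint_one_eq hcv hva] at c4
  rw [edgePoint_one_eq hva hab] at c5
  have d1 := truncDist_of_adj hab
  have d2 := truncDist_of_adj hbc
  have d3 := truncDist_of_adj hcv
  have d4 := truncDist_of_adj hva
  have d1' := truncDist_of_adj hab.symm
  have d2' := truncDist_of_adj hbc.symm
  have d3' := truncDist_of_adj hcv.symm
  have d4' := truncDist_of_adj hva.symm
  have d5 := one_le_truncDist (G := G) hac
  have d6 := one_le_truncDist (G := G) hbv
  have d5' := one_le_truncDist (G := G) hac.symm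
  have d6' := one_le_truncDist (G := G) hbv.symm
  have n1 := hab.ne
  have n2 := hbc.ne
  have n3 := hcv.ne
  have n4 := hva.ne
  have hd : ENNReal.ofReal 2 ≤ edist (edgePoint hab (1 / 2)) (edgePoint hcv (1 / 2)) := by
    refine le_edist_edgePoint _ _ ?_ ?_ ?_ ?_ ?_ ?_ ?_ ?_ ?_ <;>
      first
      | (rw [Ne, Sym2.eq_iff]; grind)
      | linarith
  refine le_hyperbolicityConst_of_bigon (p := edgePoint hbc (1 / 2))
    (((c1.trans c2).trans c3).isGeodesicSegment (by convert hd using 2; norm_num))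
    (((c4.trans c5).trans c6).isGeodesicSegment (by rw [edist_comm]; convert hd using 2; norm_num))
    (Or.inl (Or.inr ⟨1 / 2, ⟨by norm_num, by norm_num⟩, rfl⟩)) ?_
  rintro q ((⟨t, ht, rfl⟩ | ⟨t, ht, rfl⟩) | ⟨t, ht, rfl⟩) <;> obtain ⟨ht0, ht1⟩ := ht <;>
  refine le_edist_edgePoint _ _ ?_ ?_ ?_ ?_ ?_ ?_ ?_ ?_ ?_ <;>
      first
      | (rw [Ne, Sym2.eq_iff]; grind)
      | linarith [truncDist_nonneg (G := G) b b, truncDist_nonneg (G := G) c c]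

/-- The bigon joins `w` to the midpoint of `xy`; its arcs of length `5/2` are geodesics because `w`
is at distance at least 2 from both `x` and `y`. Chords `uv` and `xv` are harmless. The middle of
the arc through `u` is on `ux`, at distance `1/4` from `u`. -/
theorem five_quarters_le_hyperbolicity {w u x y v : V} (hwu : G.Adj w u) (hux : G.Adj u x)
    (hxy : G.Adj x y) (hyv : G.Adj y v) (hvw : G.Adj v w) (huv : u ≠ v) (hxv : x ≠ v)
    (hwx : ¬ G.Adj w x) (hwy : ¬ G.Adj w y) : ENNReal.ofReal (5 / 4) ≤ G.hyperbolicity := by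
  have nwx : w ≠ x := fun h => hwy (h ▸ hxy)
  have nwy : w ≠ y := fun h => hwx (h ▸ hxy.symm)
  have nuy : u ≠ y := fun h => hwy (h ▸ hwu)
  have c1 := isCurveOfLength_edgePoint hwu (s := 0) (t := 1) le_rfl zero_le_one le_rfl
  have c2 := isCurveOfLength_edgePoint hux (s := 0) (t := 1) le_rfl zero_le_one le_rfl
  have c3 := isCurveOfLength_edgePoint hxy (s := 0) (t := 1 / 2) le_rfl (by norm_num) (by norm_num)
  have c4 := isCurveOfLength_edgePoint hxy (s := 1 / 2) (t := 1) (by norm_num) (by norm_num) le_rfl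
  have c5 := isCurveOfLength_edgePoint hyv (s := 0) (t := 1) le_rfl zero_le_one le_rfl
  have c6 := isCurveOfLength_edgePoint hvw (s := 0) (t := 1) le_rfl zero_le_one le_rfl
  rw [edgePoint_one_eq hwu hux] at c1
  rw [edgePoint_one_eq hux hxy] at c2
  rw [edgePoint_one_eq hxy hyv] at c4
  rw [edgePoint_one_eq hyv hvw] at c5
  rw [edgePoint_one_eq hvw hwu] at c6
  have d1 := truncDist_of_adj hwu
  have d2 := truncDist_of_adj hux
  have d3 := truncDist_of_adj hxy
  have d1' := truncDist_of_adj hwu.symm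
  have d4 := truncDist_of_not_adj nwx hwx
  have d5 := truncDist_of_not_adj nwy hwy
  have d6 := one_le_truncDist (G := G) nuy
  have d7 := one_le_truncDist (G := G) huv
  have d8 := one_le_truncDist (G := G) hxv
  have d9 := one_le_truncDist (G := G) nwx.symm
  have n1 := hwu.ne
  have n2 := hux.ne
  have n3 := hxy.ne
  have n4 := hyv.ne
  have n5 := hvw.ne
  have hd : ENNReal.ofReal (5 / 2) ≤ edist (edgePoint hwu 0) (edgePoint hxy (1 / 2)) := by
    refine le_edist_edgePoint _ _ ?_ ?_ ?_ ?_ ?_ ?_ ?_ ?_ ?_ <;>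
      first
      | (rw [Ne, Sym2.eq_iff]; grind)
      | linarith
  refine le_hyperbolicityConst_of_bigon (p := edgePoint hux (1 / 4))
    (((c1.trans c2).trans c3).isGeodesicSegment (by convert hd using 2; norm_num))
    (((c4.trans c5).trans c6).isGeodesicSegment (by rw [edist_comm]; convert hd using 2; norm_num))
    (Or.inl (Or.inr ⟨1 / 4, ⟨by norm_num, by norm_num⟩, rfl⟩)) ?_
  rintro q ((⟨t, ht, rfl⟩ | ⟨t, ht, rfl⟩) | ⟨t, ht, rfl⟩) <;> obtain ⟨ht0, ht1⟩ := ht <;>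
  refine le_edist_edgePoint _ _ ?_ ?_ ?_ ?_ ?_ ?_ ?_ ?_ ?_ <;>
      first
      | (rw [Ne, Sym2.eq_iff]; grind)
      | linarith [truncDist_nonneg (G := G) x x]

/-! ### Upper bounds for the hyperbolicity constant -/

/-- An isolated vertex lies on no edge; this accounts for the alternative `x = y` in
`eq_or_exists_onEdge`. -/
theorem eq_of_coord_pos_of_isolated {x y : MetricGraph G} {a : V} (hx : 0 < x.coord a)
    (hy : 0 < y.coord a) (ha : ∀ b, ¬ G.Adj a b) : x = y := by
  have key : ∀ z : MetricGraph G, 0 < z.coord a → z.coord a = 1 ∧ ∀ w, w ≠ a → z.coord w = 0 := by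
    intro z hz
    rcases z.vertex_or_interior with ⟨c, hc, h⟩ | ⟨c, d, hcd, -, -, -, h⟩
    · obtain rfl : a = c := by by_contra hn; exact hz.ne' (h a hn)
      exact ⟨hc, h⟩
    · by_cases h1 : a = c
      · exact absurd (h1 ▸ hcd) (ha d)
      by_cases h2 : a = d
      · exact absurd (h2 ▸ hcd.symm) (ha c)
      exact absurd (h a h1 h2) hz.ne'
  ext w
  by_cases hw : w = a
  · rw [hw, (key x hx).1, (key y hy).1]
  · rw [(key x hx).2 w hw, (key y hy).2 w hw]

theorem exists_onEdge_of_coord_pos {x : MetricGraph G} {a b : V} (hx : 0 < x.coord a)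
    (hab : G.Adj a b) : ∃ c, G.Adj a c ∧ x.OnEdge a c := by
  rcases x.vertex_or_interior with ⟨c, hc, h⟩ | ⟨c, d, hcd, -, -, -, h⟩
  · refine ⟨b, hab, fun w hw => Or.inl ?_⟩
    by_contra hn
    have h1 : w = c := by by_contra hn; exact hw (h w hn)
    have h2 : a = c := by by_contra hn; exact hx.ne' (h a hn)
    exact hn (h1.trans h2.symm)
  · have hon : x.OnEdge c d := fun w hw => by
      by_contra! hh; exact hw (h w hh.1 hh.2)
    rcases hon a hx.ne' with rfl | rfl
    · exact ⟨d, hcd, hon⟩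
    · exact ⟨c, hcd.symm, hon.symm⟩

theorem coord_pos_of_vertexDist_ne_top {x : MetricGraph G} {a : V} (h : vertexDist x a ≠ ⊤) :
    0 < x.coord a := by
  by_contra hn
  exact h (vertexDist_of_not_pos hn)

/-- Different points at finite distance lie on edges of the same connected component. -/
theorem eq_or_exists_onEdge {x y : MetricGraph G} (h : edist x y ≠ ⊤) :
    x = y ∨ ∃ a a' b b', G.Adj a a' ∧ G.Adj b b' ∧ x.OnEdge a a' ∧ y.OnEdge b b' ∧
      G.Reachable a b := by
  by_contra! hcon
  obtain ⟨hxy, hcon⟩ := hcon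
  refine h (top_le_iff.1 (le_pathDist (fun a b hab hx hy => ?_) fun a b => ?_))
  · exact absurd (SimpleGraph.Reachable.refl a) (hcon a b a b hab hab hx hy)
  by_contra hlt
  rw [top_le_iff, ENNReal.add_eq_top, ENNReal.add_eq_top] at hlt
  push Not at hlt
  obtain ⟨⟨h1, h2⟩, h3⟩ := hlt
  have hx := coord_pos_of_vertexDist_ne_top h1
  have hy := coord_pos_of_vertexDist_ne_top h3
  have hr : G.Reachable a b := by
    rw [← SimpleGraph.edist_ne_top_iff_reachable]
    simpa using h2
  by_cases hn : a = b
  · subst hn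
    by_cases ha : ∃ c, G.Adj a c
    · obtain ⟨c, hc⟩ := ha
      obtain ⟨a', ha', hxa⟩ := exists_onEdge_of_coord_pos hx hc
      obtain ⟨b', hb', hyb⟩ := exists_onEdge_of_coord_pos hy hc
      exact hcon a a' a b' ha' hb' hxa hyb hr
    · exact hxy (eq_of_coord_pos_of_isolated hx hy (by simpa using ha))
  · obtain ⟨c, hc⟩ : ∃ c, G.Adj a c := by
      obtain ⟨p⟩ := hr
      cases p with
      | nil => exact absurd rfl hn
      | cons h _ => exact ⟨_, h⟩
    obtain ⟨d, hd⟩ : ∃ c, G.Adj b c := by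
      obtain ⟨p⟩ := hr.symm
      cases p with
      | nil => exact absurd rfl hn
      | cons h _ => exact ⟨_, h⟩
    obtain ⟨a', ha', hxa⟩ := exists_onEdge_of_coord_pos hx hc
    obtain ⟨b', hb', hyb⟩ := exists_onEdge_of_coord_pos hy hd
    exact hcon a a' b b' ha' hb' hxa hyb hr

theorem hyperbolicity_eq_zero_of_no_edge (hG : ∀ a b, ¬ G.Adj a b) : G.hyperbolicity = 0 := by
  have := hyperbolicityConst_le_of_edist_le (X := MetricGraph G) (D := 0) fun p q h => by
    rcases eq_or_exists_onEdge h with rfl | ⟨a, a', -, -, h, -⟩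
    · simp
    · exact absurd h (hG a a')
  exact le_antisymm (this.trans_eq (by simp)) zero_le

theorem OnEdge.coord_le_one {x : MetricGraph G} {a b : V} (h : x.OnEdge a b) (hab : a ≠ b) :
    x.coord a ≤ 1 := by
  linarith [h.add_eq_one hab, x.coord_nonneg b]

/-- Every component is a single vertex or a single edge, hence of diameter at most 1. -/
theorem hyperbolicity_le_half_of_forall_eq
    (hG : ∀ a b c, G.Adj a b → G.Adj b c → a = c) : G.hyperbolicity ≤ (1 / 2 : ℝ≥0) := by
  refine hyperbolicityConst_le_of_edist_le fun p q h => ?_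
  rcases eq_or_exists_onEdge h with rfl | ⟨a, a', b, b', haa, hbb, hp, hq, hr⟩
  · simp
  have hq' : q.OnEdge a a' := by
    -- Along a walk, two consecutive steps return to the same vertex, so the walk never leaves one
    -- edge.
    have : a = b ∨ G.Adj a b := by
      obtain ⟨w⟩ := hr
      clear hp hq haa hbb
      induction w with
      | nil => exact Or.inl rfl
      | cons h w ih =>
        rcases ih with rfl | h'
        · exact Or.inr h
        · exact Or.inl (hG _ _ _ h h')
    rcases this with rfl | hab
    · rwa [hG a' a b' haa.symm hbb]
    · rw [hG a b b' hab hbb, hG a' a b haa.symm hab]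
      exact hq.symm
  rw [edist_def]
  refine (pathDist_le_of_onEdge haa hp hq').trans ?_
  have h1 := hp.coord_le_one haa.ne
  have h2 := hq'.coord_le_one haa.ne
  have h3 := p.coord_nonneg a
  have h4 := q.coord_nonneg a
  rw [ENNReal.ofReal_le_iff_le_toReal (by simp)]
  simpa [abs_le] using ⟨by linarith, by linarith⟩

theorem edist_edgePoint_zero_le_one {a a' b b' : V} (ha : G.Adj a a') (hb : G.Adj b b')
    (h : a = b ∨ G.Adj a b) : edist (edgePoint ha 0) (edgePoint hb 0) ≤ ENNReal.ofReal 1 := by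
  rw [edist_def]
  refine (pathDist_le_via _ _ a b).trans ?_
  rw [vertexDist_of_pos, vertexDist_of_pos, edgePoint_coord_left _ le_rfl zero_le_one,
    edgePoint_coord_left _ le_rfl zero_le_one]
  · rcases h with rfl | h
    · simp
    · simp [SimpleGraph.edist_eq_one_iff_adj.2 h]
  all_goals rw [edgePoint_coord_left _ le_rfl zero_le_one]; norm_num

theorem edist_le_of_onEdge {x y : MetricGraph G} {a a' b b' : V} (ha : G.Adj a a')
    (hb : G.Adj b b') (hx : x.OnEdge a a') (hy : y.OnEdge b b') (h : a = b ∨ G.Adj a b) :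
    edist x y ≤ ENNReal.ofReal ((1 - x.coord a) + 1 + (1 - y.coord b)) := by
  have h1 := hx.coord_le_one ha.ne
  have h2 := hy.coord_le_one hb.ne
  have key : ∀ {z : MetricGraph G} {c c' : V} (hc : G.Adj c c'), z.OnEdge c c' →
      edist z (edgePoint hc 0) ≤ ENNReal.ofReal (1 - z.coord c) := by
    intro z c c' hc hz
    have := hz.coord_le_one hc.ne
    rw [edist_def]
    refine (pathDist_le_of_onEdge hc hz (edgePoint_onEdge _ _)).trans_eq ?_
    rw [edgePoint_coord_left _ le_rfl zero_le_one, abs_sub_comm, sub_zero, abs_of_nonneg]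
    linarith
  rw [ENNReal.ofReal_add (by linarith) (by linarith), ENNReal.ofReal_add (by linarith) zero_le_one]
  refine (edist_triangle4 x (edgePoint ha 0) (edgePoint hb 0) y).trans ?_
  refine add_le_add (add_le_add (key ha hx) (edist_edgePoint_zero_le_one ha hb h)) ?_
  rw [edist_comm]
  exact key hb hy

/-- If paths with four vertices have a chord from the first vertex, then the vertices of a
connected component which are not adjacent have the same neighbors. -/
theorem adj_of_reachable_of_not_adj
    (hG : ∀ w u x y, G.Adj w u → G.Adj u x → G.Adj x y → G.Adj w x ∨ G.Adj w y) {a b : V}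
    (hr : G.Reachable a b) (h : ¬ (a = b ∨ G.Adj a b)) {c : V} (hbc : G.Adj b c) : G.Adj a c := by
  have main : a = b ∨ G.Adj a b ∨ ∀ c, G.Adj b c → G.Adj a c := by
    -- Induction on a walk from `b` to `a`. If the second vertex `z` of the walk is adjacent to `a`,
    -- the hypothesis on the walk `a z b c` makes `a` adjacent to `b` or to `c`.
    obtain ⟨w⟩ := hr.symm
    clear h hr hbc
    induction w with
    | nil => exact Or.inl rfl
    | cons h w ih =>
      rcases ih with rfl | h' | h'
      · exact Or.inr (Or.inl h.symm)
      · refine Or.inr (or_iff_not_imp_left.2 fun hn c hc => ?_)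
        exact (hG _ _ _ _ h' h.symm hc).resolve_left hn
      · exact Or.inr (Or.inl (h' _ h.symm))
  tauto

/-- The components have diameter at most 2: the endpoints of the edges carrying two points can be
paired so that paired vertices are equal or adjacent. -/
theorem hyperbolicity_le_one_of_forall_adj
    (hG : ∀ w u x y, G.Adj w u → G.Adj u x → G.Adj x y → G.Adj w x ∨ G.Adj w y) :
    G.hyperbolicity ≤ (2 / 2 : ℝ≥0) := by
  refine hyperbolicityConst_le_of_edist_le fun p q h => ?_
  rcases eq_or_exists_onEdge h with rfl | ⟨a, a', b, b', ha, hb, hp, hq, hr⟩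
  · simp
  -- The bounds for the two routes, through `a, b` and through `a', b'`, add up to 4, so one of them
  -- is at most 2.
  have main : ∀ {a a' b b' : V}, G.Adj a a' → G.Adj b b' → p.OnEdge a a' → q.OnEdge b b' →
      (a = b ∨ G.Adj a b) → (a' = b' ∨ G.Adj a' b') → edist p q ≤ ENNReal.ofReal 2 := by
    intro a a' b b' ha hb hp hq h h'
    have e1 := edist_le_of_onEdge ha hb hp hq h
    have e2 := edist_le_of_onEdge ha.symm hb.symm hp.symm hq.symm h'
    have h1 := hp.add_eq_one ha.ne
    have h2 := hq.add_eq_one hb.ne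
    rcases le_total 1 (p.coord a + q.coord b) with hle | hle
    · exact e1.trans (ENNReal.ofReal_le_ofReal (by linarith))
    · exact e2.trans (ENNReal.ofReal_le_ofReal (by linarith))
  have hr' : G.Reachable a' b' := ha.symm.reachable.trans (hr.trans hb.reachable)
  have hsymm : ∀ {c d : V}, ¬ (c = d ∨ G.Adj c d) → ¬ (d = c ∨ G.Adj d c) := by
    intro c d h h'
    exact h (h'.imp Eq.symm fun h => h.symm)
  have two : ENNReal.ofReal 2 = ((2 : ℝ≥0) : ℝ≥0∞) := by simp
  rw [← two]
  -- If a pair is neither equal nor adjacent, its vertices have the same neighbors, and the crossed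
  -- pairing `a, b'` and `a', b` consists of adjacent vertices.
  by_cases h1 : a = b ∨ G.Adj a b
  · by_cases h2 : a' = b' ∨ G.Adj a' b'
    · exact main ha hb hp hq h1 h2
    · exact main ha hb.symm hp hq.symm
        (Or.inr (adj_of_reachable_of_not_adj hG hr'.symm (hsymm h2) ha.symm).symm)
        (Or.inr (adj_of_reachable_of_not_adj hG hr' h2 hb.symm))
  · exact main ha hb.symm hp hq.symm (Or.inr (adj_of_reachable_of_not_adj hG hr h1 hb))
      (Or.inr (adj_of_reachable_of_not_adj hG hr.symm (hsymm h1) ha).symm)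

/-- The case of a graph `G` with a vertex whose neighborhood contains `H` as an induced
subgraph. -/
theorem min_hyperbolicity_le_of_cone {W : Type v} {H : SimpleGraph W} (f : H ↪g G) (v : V)
    (hv : ∀ a, G.Adj (f a) v) : min (5 / 4 : ℝ≥0∞) H.hyperbolicity ≤ G.hyperbolicity := by
  have cast54 : ENNReal.ofReal (5 / 4) = 5 / 4 := by
    rw [ENNReal.ofReal_div_of_pos (by norm_num)]; simp
  -- Walks with a repeated vertex satisfy this condition automatically, so a failure gives four
  -- distinct vertices; with `v` they form a 5-cycle.
  by_cases hP : ∀ w u x y, H.Adj w u → H.Adj u x → H.Adj x y → H.Adj w x ∨ H.Adj w y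
  swap
  · push Not at hP
    obtain ⟨w, u, x, y, h1, h2, h3, h4, h5⟩ := hP
    refine (min_le_left _ _).trans (cast54.symm.le.trans ?_)
    exact five_quarters_le_hyperbolicity (f.map_adj_iff.2 h1) (f.map_adj_iff.2 h2)
      (f.map_adj_iff.2 h3) (hv y) (hv w).symm (hv u).ne (hv x).ne
      (fun h => h4 (f.map_adj_iff.1 h)) (fun h => h5 (f.map_adj_iff.1 h))
  refine (min_le_right _ _).trans ?_
  by_cases h3 : ∀ a b c, H.Adj a b → H.Adj b c → a = c
  swap
  · push Not at h3
    -- Here `a b c v` is a 4-cycle, and its bound 1 matches the upper bound for `H`.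
    obtain ⟨a, b, c, hab, hbc, hac⟩ := h3
    refine (hyperbolicity_le_one_of_forall_adj hP).trans (le_trans ?_
      (one_le_hyperbolicity (f.map_adj_iff.2 hab) (f.map_adj_iff.2 hbc) (hv c) (hv a).symm
        (f.injective.ne hac) (hv b).ne))
    simp
  by_cases h2 : ∀ a b, ¬ H.Adj a b
  · rw [hyperbolicity_eq_zero_of_no_edge h2]
    exact zero_le
  · push Not at h2
    obtain ⟨a, b, hab⟩ := h2
    -- The triangle `v a b` gives `3/4`, more than the required `1/2`.
    refine (hyperbolicity_le_half_of_forall_eq h3).trans (le_trans ?_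
      (three_quarters_le_hyperbolicity (hv a).symm (f.map_adj_iff.2 hab) (hv b)))
    rw [← ENNReal.ofReal_coe_nnreal]
    exact ENNReal.ofReal_le_ofReal (by norm_num)

end MetricGraph

/-! ### The two factors as induced subgraphs of the join, and the theorem -/

namespace SimpleGraph

variable {V₁ : Type u} {V₂ : Type v} (G₁ : SimpleGraph V₁) (G₂ : SimpleGraph V₂)

/-- The first graph is an induced subgraph of the join. -/
def graphJoinInl : G₁ ↪g graphJoin G₁ G₂ where
  toFun := Sum.inl
  inj' := Sum.inl_injective
  map_rel_iff' := by simp [graphJoin]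

/-- The second graph is an induced subgraph of the join. -/
def graphJoinInr : G₂ ↪g graphJoin G₁ G₂ where
  toFun := Sum.inr
  inj' := Sum.inr_injective
  map_rel_iff' := by simp [graphJoin]

end SimpleGraph

theorem corollaryc {V₁ : Type u} {V₂ : Type v} [Nonempty V₁] [Nonempty V₂]
    (G₁ : SimpleGraph V₁) (G₂ : SimpleGraph V₂) :
    min (5 / 4 : ℝ≥0∞) (max G₁.hyperbolicity G₂.hyperbolicity) ≤
      (SimpleGraph.graphJoin G₁ G₂).hyperbolicity := by
  -- The two factors are treated separately, each with an arbitrary vertex of the other one as `v`.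
  rw [min_max_distrib_left]
  refine max_le ?_ ?_
  · refine MetricGraph.min_hyperbolicity_le_of_cone (G₁.graphJoinInl G₂)
      (Sum.inr (Classical.arbitrary V₂)) fun a => ?_
    change (SimpleGraph.graphJoin G₁ G₂).Adj (Sum.inl a) _
    simp [SimpleGraph.graphJoin]
  · refine MetricGraph.min_hyperbolicity_le_of_cone (G₁.graphJoinInr G₂)
      (Sum.inl (Classical.arbitrary V₁)) fun a => ?_
    change (SimpleGraph.graphJoin G₁ G₂).Adj (Sum.inr a) _
    simp [SimpleGraph.graphJoin]
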